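/- Let $S$ be a finite linearly ordered set. A hypergraph on $S$ is a family of subsets of $S$ (its hyperedges). A hypergraph $\mathcal F$ on $S$ is called ABA-free if there are no two hyperedges $A,B\in\mathcal F$ and vertices $x<y<z$ in $S$ such that $x,z\in A\setminus B$ and $y\in B\setminus A$. A hypergraph $\mathcal H$ on $S$ is called a pseudohemisphere hypergraph if there exist a set $X\subseteq S$ and an ABA-free hypergraph $\mathcal F$ on $S$ such that $\mathcal H\subseteq\{F\,\Delta\,X,\ \bar F\,\Delta\,X \mid F\in\mathcal F\}$, where $\bar F=S\setminus F$ and $\Delta$ denotes symmetric difference. **Theorem 3.3** (Dual discrete Helly theorem for pseudohemispheres, $4\to+1$). Let $\mathcal H$ be a pseudohemisphere hypergraph on $S$ and let $S'\subseteq S$ be such that every set of $4$ distinct vertices of $S'$ is contained in some hyperedge of $\mathcal H$. Then there exists a set $E\subseteq S$ with $S'\subseteq E$ such that $\mathcal H\cup\{E\}$ is a pseudohemisphere hypergraph on $S$ (with the same vertex order). -/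

import Mathlib

open scoped symmDiff

/-- A hypergraph `F` (a family of vertex sets) on a linearly ordered vertex set is ABA-free if no
two hyperedges `A`, `B` admit vertices `x < y < z` with `x, z ∈ A \ B` and `y ∈ B \ A`. -/
def IsABAFree {S : Type*} [LinearOrder S] (F : Set (Set S)) : Prop :=
  ∀ A ∈ F, ∀ B ∈ F, ¬ ∃ x y z : S, x < y ∧ y < z ∧ x ∈ A \ B ∧ y ∈ B \ A ∧ z ∈ A \ B

/-- A hypergraph `H` on a linearly ordered vertex set `S` is a pseudohemisphere hypergraph if there
are a vertex set `X` and an ABA-free hypergraph `F` on `S` (with the same order) such that every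
hyperedge of `H` is of the form `A ∆ X` or `Aᶜ ∆ X` with `A ∈ F`. -/
def IsPseudohemisphereHypergraph {S : Type*} [LinearOrder S] (H : Set (Set S)) : Prop :=
  ∃ (X : Set S) (F : Set (Set S)), IsABAFree F ∧ H ⊆ {E | ∃ A ∈ F, E = A ∆ X ∨ E = Aᶜ ∆ X}

/-! A hyperedge `A ∆ X` or `Aᶜ ∆ X` contains `T` exactly when `A` agrees on `T` with `Xᶜ` or `X`
respectively. So it suffices to add to `F` some `Y` that agrees on `S'` with `X` or `Xᶜ`. What
obstructs `X` on `S'` is a triple where `X` alternates and some member of `F` equals `Xᶜ`; for `Xᶜ`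
the roles are exchanged. By ABA-freeness no triple is of both kinds, and the condition on quadruples
carries the kind between triples sharing two vertices, hence to all alternating triples
(`IsABAFree.isPositiveTriple_iff`). So `X` or `Xᶜ` is unobstructed on `S'`. Such a partial set
extends one vertex at a time (`IsABAFree.exists_compatibleOn_insert`): if both choices at `s`
failed, the two members of `F` responsible would alternate with each other. -/

/-- `Y` and `A` do not alternate twice (in either direction) along the vertices of `D`, with respect
to the strict order `lt`. -/
def CompatibleOn {S : Type*} (lt : S → S → Prop) (D Y A : Set S) : Prop :=
  ∀ p ∈ D, ∀ q ∈ D, ∀ r ∈ D, lt p q → lt q r →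
    ¬ (p ∈ Y \ A ∧ q ∈ A \ Y ∧ r ∈ Y \ A) ∧ ¬ (p ∈ A \ Y ∧ q ∈ Y \ A ∧ r ∈ A \ Y)

/-- The cyclic rotation of a linear order in which `s` becomes the last element. -/
def RotatedLT {S : Type*} [LinearOrder S] (s a b : S) : Prop :=
  (a < b ∧ b < s) ∨ (s < a ∧ a < b) ∨ (s < a ∧ b < s) ∨ (a ≠ s ∧ b = s)

section
variable {S : Type*}

theorem CompatibleOn.compl {lt : S → S → Prop} {D Y A : Set S} (h : CompatibleOn lt D Y A) :
    CompatibleOn lt D Yᶜ Aᶜ := by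
  intro p hp q hq r hr hpq hqr
  have := h p hp q hq r hr hpq hqr
  simp only [Set.mem_sdiff, Set.mem_compl_iff, not_not] at *
  tauto

theorem CompatibleOn.congr {lt : S → S → Prop} {D Y Y' A : Set S} (h : CompatibleOn lt D Y A)
    (hY : ∀ t ∈ D, (t ∈ Y ↔ t ∈ Y')) : CompatibleOn lt D Y' A := by
  intro p hp q hq r hr hpq hqr
  simpa only [Set.mem_sdiff, hY p hp, hY q hq, hY r hr] using h p hp q hq r hr hpq hqr

/-! ### Cyclic rotation of the order -/

theorem RotatedLT.trichotomy [LinearOrder S] (s a b : S) :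
    RotatedLT s a b ∨ a = b ∨ RotatedLT s b a := by
  unfold RotatedLT
  rcases lt_trichotomy a b with h | h | h <;> rcases lt_trichotomy a s with h1 | h1 | h1 <;>
    rcases lt_trichotomy b s with h2 | h2 | h2 <;> grind

theorem RotatedLT.trans [LinearOrder S] {s a b c : S} (h : RotatedLT s a b)
    (h' : RotatedLT s b c) : RotatedLT s a c := by
  unfold RotatedLT at *
  grind

/-- Flipping membership beyond `s` swaps `Y \ A` and `A \ Y` there. Moving that block to the front
therefore turns an alternating triple into an alternating triple, cyclically shifted. -/
theorem CompatibleOn.rotated [LinearOrder S] {D Y A : Set S} {s : S}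
    (h : CompatibleOn (· < ·) D Y A) :
    CompatibleOn (RotatedLT s) D (Y ∆ Set.Ioi s) (A ∆ Set.Ioi s) := by
  intro p hp q hq r hr hpq hqr
  have h1 := h p hp q hq r hr
  have h2 := h q hq r hr p hp
  have h3 := h r hr p hp q hq
  clear h hp hq hr
  simp only [RotatedLT, Set.mem_symmDiff, Set.mem_sdiff, Set.mem_Ioi] at *
  rcases lt_trichotomy p s with h4 | h4 | h4 <;> rcases lt_trichotomy q s with h5 | h5 | h5 <;>
    rcases lt_trichotomy r s with h6 | h6 | h6 <;> grind

theorem CompatibleOn.of_rotated [LinearOrder S] {D Y A : Set S} {s : S}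
    (h : CompatibleOn (RotatedLT s) D (Y ∆ Set.Ioi s) (A ∆ Set.Ioi s)) :
    CompatibleOn (· < ·) D Y A := by
  intro p hp q hq r hr hpq hqr
  have h1 := h p hp q hq r hr
  have h2 := h q hq r hr p hp
  have h3 := h r hr p hp q hq
  clear h hp hq hr
  simp only [RotatedLT, Set.mem_symmDiff, Set.mem_sdiff, Set.mem_Ioi] at *
  rcases lt_trichotomy p s with h4 | h4 | h4 <;> rcases lt_trichotomy q s with h5 | h5 | h5 <;>
    rcases lt_trichotomy r s with h6 | h6 | h6 <;> grind

/-! ### Extension of a compatible set by further vertices -/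

theorem exists_obstruction_of_not_compatibleOn_insert {lt : S → S → Prop} {D Y A : Set S} {s : S}
    (hs : ∀ t, ¬ lt s t) (hsY : s ∈ Y) (h : CompatibleOn lt D Y A)
    (h' : ¬ CompatibleOn lt (insert s D) Y A) :
    s ∉ A ∧ ∃ j ∈ D, ∃ k ∈ D, lt j k ∧ j ∈ Y \ A ∧ k ∈ A \ Y := by
  contrapose! h'
  intro p hp q hq r hr hpq hqr
  rcases hp with rfl | hp
  · exact absurd hpq (hs _)
  rcases hq with rfl | hq
  · exact absurd hqr (hs _)
  rcases hr with rfl | hr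
  · exact ⟨fun hc => h' hc.2.2.2 p hp q hq hpq hc.1 hc.2.1, fun hc => hc.2.2.2 hsY⟩
  · exact h p hp q hq r hr hpq hqr

/-- One of the two ways of adding a last vertex `s` to `D` is compatible with both `A` and `B`. -/
theorem compatibleOn_insert_of_last {lt : S → S → Prop} {D Y A B : Set S} {s : S}
    (htri : ∀ a b, lt a b ∨ a = b ∨ lt b a) (htrans : ∀ a b c, lt a b → lt b c → lt a c)
    (hs : ∀ t, ¬ lt s t) (hsD : ∀ t ∈ D, lt t s)
    (hA : CompatibleOn lt D Y A) (hB : CompatibleOn lt D Y B)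
    (hAB : CompatibleOn lt (insert s D) A B) {Y₁ Y₂ : Set S}
    (hY₁ : ∀ t ∈ D, (t ∈ Y ↔ t ∈ Y₁)) (hY₂ : ∀ t ∈ D, (t ∈ Y ↔ t ∈ Y₂))
    (h₁ : s ∈ Y₁) (h₂ : s ∉ Y₂) :
    CompatibleOn lt (insert s D) Y₁ A ∨ CompatibleOn lt (insert s D) Y₂ B := by
  by_contra! hcon
  obtain ⟨hsA, j, hj, k, hk, hjk, hjA, hkA⟩ :=
    exists_obstruction_of_not_compatibleOn_insert hs h₁ (hA.congr hY₁) hcon.1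
  obtain ⟨hsB, j', hj', k', hk', hjk', hjB, hkB⟩ :=
    exists_obstruction_of_not_compatibleOn_insert (Y := Y₂ᶜ) (A := Bᶜ) hs h₂ (hB.congr hY₂).compl
      (fun h => hcon.2 (by simpa only [compl_compl] using h.compl))
  simp only [Set.mem_sdiff, Set.mem_compl_iff, not_not, ← hY₁ j hj, ← hY₁ k hk, ← hY₂ j' hj',
    ← hY₂ k' hk'] at hjA hkA hjB hkB hsB
  have hks := hsD k hk
  have hks' := hsD k' hk'
  have hD : ∀ t ∈ D, t ∈ insert s D := fun t => Set.mem_insert_of_mem s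
  have a1 := hA j' hj' j hj k hk
  have a2 := hA j hj k hk k' hk'
  have a3 := hA j' hj' k' hk' k hk
  have b1 := hB j hj j' hj' k' hk'
  have b2 := hB j' hj' k' hk' k hk
  have b3 := hB j' hj' j hj k hk
  have c1 := hAB j (hD j hj) k' (hD k' hk') s (Set.mem_insert s D)
  have c2 := hAB j' (hD j' hj') k (hD k hk) s (Set.mem_insert s D)
  have t1 := htri j j'
  have t2 := htri j k'
  have t3 := htri k k'
  have u1 := htrans j' j k
  have u2 := htrans j' k' k
  have u3 := htrans k' j k
  have u4 := htrans j' k' j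
  simp only [Set.mem_sdiff] at *
  clear hA hB hAB hY₁ hY₂ hD hs hsD htri htrans hcon h₁ h₂
  -- If `j` precedes `k'`, `j ∈ B` and `k' ∈ A`, then `A` and `B` alternate along `j, k', s`.
  -- Otherwise compatibility of `Y` with `A` and `B` forces `j'` before `k`, `j' ∉ A` and `k ∉ B`,
  -- so they alternate along `j', k, s`.
  rcases t2 with t2 | rfl | t2
  · by_cases hjB' : j ∈ B
    · by_cases hkA' : k' ∈ A <;> grind
    · grind
  · grind
  · grind

theorem IsABAFree.compatibleOn [LinearOrder S] {F : Set (Set S)} (hF : IsABAFree F) {A B : Set S}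
    (hA : A ∈ F) (hB : B ∈ F) (D : Set S) : CompatibleOn (· < ·) D A B :=
  fun p _ q _ r _ hpq hqr =>
    ⟨fun h => hF A hA B hB ⟨p, q, r, hpq, hqr, h.1, h.2.1, h.2.2⟩,
      fun h => hF B hB A hA ⟨p, q, r, hpq, hqr, h.1, h.2.1, h.2.2⟩⟩

/-- A set compatible with an ABA-free family on `D` can be changed at a further vertex `s` so as to
be compatible on `insert s D`. -/
theorem IsABAFree.exists_compatibleOn_insert [LinearOrder S] {F : Set (Set S)} (hF : IsABAFree F)
    {D Y : Set S} {s : S} (hsD : s ∉ D) (hY : ∀ A ∈ F, CompatibleOn (· < ·) D Y A) :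
    ∃ Y' : Set S, (∀ t ∈ D, (t ∈ Y ↔ t ∈ Y')) ∧
      ∀ A ∈ F, CompatibleOn (· < ·) (insert s D) Y' A := by
  by_contra! hcon
  have hne : ∀ t ∈ D, t ≠ s := fun t ht h => hsD (h ▸ ht)
  have h₁ : ∀ t ∈ D, (t ∈ Y ↔ t ∈ insert s Y) := fun t ht => by simp [hne t ht]
  have h₂ : ∀ t ∈ D, (t ∈ Y ↔ t ∈ Y \ {s}) := fun t ht => by simp [hne t ht]
  obtain ⟨A, hA, hYA⟩ := hcon _ h₁
  obtain ⟨B, hB, hYB⟩ := hcon _ h₂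
  -- Rotation reduces to the case where `s` is the last vertex.
  rcases compatibleOn_insert_of_last (lt := RotatedLT s) (s := s) (RotatedLT.trichotomy s)
    (fun _ _ _ => RotatedLT.trans) (by grind [RotatedLT]) (by grind [RotatedLT])
    (hY A hA).rotated (hY B hB).rotated (hF.compatibleOn hA hB (insert s D)).rotated
    (Y₁ := insert s Y ∆ Set.Ioi s) (Y₂ := (Y \ {s}) ∆ Set.Ioi s)
    (fun t ht => by simp only [Set.mem_symmDiff, h₁ t ht])
    (fun t ht => by simp only [Set.mem_symmDiff, h₂ t ht])
    (by simp [Set.mem_symmDiff]) (by simp [Set.mem_symmDiff]) with h | h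
  · exact hYA h.of_rotated
  · exact hYB h.of_rotated

/-- A set compatible with an ABA-free family on `D` agrees on `D` with a set that can be added to
the family. -/
theorem IsABAFree.exists_insert [LinearOrder S] [Finite S] {F : Set (Set S)} (hF : IsABAFree F)
    {D Y : Set S} (hY : ∀ A ∈ F, CompatibleOn (· < ·) D Y A) :
    ∃ Y' : Set S, (∀ t ∈ D, (t ∈ Y ↔ t ∈ Y')) ∧ IsABAFree (insert Y' F) := by
  obtain ⟨Y', h₁, h₂⟩ : ∃ Y' : Set S, (∀ t ∈ D, (t ∈ Y ↔ t ∈ Y')) ∧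
      ∀ A ∈ F, CompatibleOn (· < ·) (Set.univ ∪ D) Y' A := by
    -- The union with `D` lets the induction start from `Y` itself.
    induction (Set.univ : Set S), Set.finite_univ (α := S) using Set.Finite.induction_on with
    | empty => exact ⟨Y, fun _ _ => Iff.rfl, by simpa using hY⟩
    | @insert s C _ _ ih =>
      obtain ⟨Y', h₁, h₂⟩ := ih
      rw [Set.insert_union]
      by_cases hs : s ∈ C ∪ D
      · exact ⟨Y', h₁, by rwa [Set.insert_eq_of_mem hs]⟩
      · obtain ⟨Y'', h₃, h₄⟩ := hF.exists_compatibleOn_insert hs h₂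
        exact ⟨Y'', fun t ht => (h₁ t ht).trans (h₃ t (Or.inr ht)), h₄⟩
  refine ⟨Y', h₁, ?_⟩
  rintro A (rfl | hA) B (rfl | hB) ⟨x, y, z, hxy, hyz, hx, hy, hz⟩
  · exact hx.2 hx.1
  · exact (h₂ B hB x (by simp) y (by simp) z (by simp) hxy hyz).1 ⟨hx, hy, hz⟩
  · exact (h₂ A hA x (by simp) y (by simp) z (by simp) hxy hyz).2 ⟨hx, hy, hz⟩
  · exact hF A hA B hB ⟨x, y, z, hxy, hyz, hx, hy, hz⟩

/-! ### Signs of alternating triples -/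

/-- Some member of `F` agrees with `Z` on the vertices `a`, `b`, `c`. -/
def IsPositiveTriple (F : Set (Set S)) (Z : Set S) (a b c : S) : Prop :=
  ∃ A ∈ F, ∀ t ∈ ({a, b, c} : Set S), (t ∈ A ↔ t ∈ Z)

/-- `a < b < c` are vertices of `D` along which membership in `Z` alternates. -/
def IsAlternating [LinearOrder S] (D Z : Set S) (a b c : S) : Prop :=
  a ∈ D ∧ b ∈ D ∧ c ∈ D ∧ a < b ∧ b < c ∧ (a ∈ Z ↔ b ∉ Z) ∧ (b ∈ Z ↔ c ∉ Z)

section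
variable [LinearOrder S] {F : Set (Set S)} {D Z : Set S}

theorem IsAlternating.compl {a b c : S} (h : IsAlternating D Z a b c) :
    IsAlternating D Zᶜ a b c := by
  simp only [IsAlternating, Set.mem_compl_iff] at *
  tauto

/-- No alternating triple is positive for both `Z` and `Zᶜ`. -/
theorem IsABAFree.not_isPositiveTriple_compl (hF : IsABAFree F) {a b c : S}
    (h : IsAlternating D Z a b c) (hp : IsPositiveTriple F Z a b c) :
    ¬ IsPositiveTriple F Zᶜ a b c := by
  rintro ⟨B, hB, hBZ⟩
  obtain ⟨A, hA, hAZ⟩ := hp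
  obtain ⟨-, -, -, hab, hbc, h1, h2⟩ := h
  have := hF.compatibleOn hA hB Set.univ a trivial b trivial c trivial hab hbc
  have a1 := hAZ a (by simp)
  have a2 := hAZ b (by simp)
  have a3 := hAZ c (by simp)
  have b1 := hBZ a (by simp)
  have b2 := hBZ b (by simp)
  have b3 := hBZ c (by simp)
  simp only [Set.mem_sdiff, Set.mem_compl_iff] at *
  tauto

/-- Positivity passes between alternating triples with two common vertices. -/
theorem IsABAFree.isPositiveTriple_of_share (hF : IsABAFree F)
    (h4 : ∀ T : Finset S, T.card = 4 → (T : Set S) ⊆ D →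
      ∃ A ∈ F, (∀ t ∈ T, (t ∈ A ↔ t ∈ Z)) ∨ ∀ t ∈ T, (t ∈ A ↔ t ∈ Zᶜ))
    {a b c a' b' c' d : S} (h : IsAlternating D Z a b c)
    (hd : d ∈ D) (hsub : ∀ t ∈ ({a', b', c'} : Set S), t = a ∨ t = b ∨ t = c ∨ t = d)
    (hp : IsPositiveTriple F Z a b c) : IsPositiveTriple F Z a' b' c' := by
  by_cases hmem : d = a ∨ d = b ∨ d = c
  · obtain ⟨A, hA, hAZ⟩ := hp
    refine ⟨A, hA, fun t ht => hAZ t ?_⟩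
    simp only [Set.mem_insert_iff, Set.mem_singleton_iff]
    rcases hsub t ht with rfl | rfl | rfl | rfl <;> tauto
  · have hcard : ({a, b, c, d} : Finset S).card = 4 := by
      have hab := h.2.2.2.1
      have hbc := h.2.2.2.2.1
      push Not at hmem
      rw [Finset.card_eq_succ]
      refine ⟨d, {a, b, c}, by simp [hmem], by ext; simp; tauto, ?_⟩
      rw [Finset.card_eq_three]
      exact ⟨a, b, c, hab.ne, (hab.trans hbc).ne, hbc.ne, rfl⟩
    obtain ⟨A, hA, hAZ | hAZ⟩ := h4 {a, b, c, d} hcard (by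
      intro t ht
      simp only [Finset.coe_insert, Finset.coe_singleton, Set.mem_insert_iff,
        Set.mem_singleton_iff] at ht
      rcases ht with rfl | rfl | rfl | rfl
      exacts [h.1, h.2.1, h.2.2.1, hd])
    · exact ⟨A, hA, fun t ht => hAZ t (by simpa using hsub t ht)⟩
    -- Agreement with `Zᶜ` on the quadruple would give `a, b, c` both signs.
    · refine absurd ⟨A, hA, fun t ht => hAZ t ?_⟩ (hF.not_isPositiveTriple_compl h hp)
      simp only [Set.mem_insert_iff, Set.mem_singleton_iff] at ht
      simp only [Finset.mem_insert, Finset.mem_singleton]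
      tauto

theorem IsABAFree.isPositiveTriple_iff_of_share (hF : IsABAFree F)
    (h4 : ∀ T : Finset S, T.card = 4 → (T : Set S) ⊆ D →
      ∃ A ∈ F, (∀ t ∈ T, (t ∈ A ↔ t ∈ Z)) ∨ ∀ t ∈ T, (t ∈ A ↔ t ∈ Zᶜ))
    {a b c a' b' c' d d' : S} (h : IsAlternating D Z a b c) (h' : IsAlternating D Z a' b' c')
    (hd : d ∈ D) (hd' : d' ∈ D)
    (hsub : ∀ t ∈ ({a', b', c'} : Set S), t = a ∨ t = b ∨ t = c ∨ t = d)
    (hsub' : ∀ t ∈ ({a, b, c} : Set S), t = a' ∨ t = b' ∨ t = c' ∨ t = d') :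
    IsPositiveTriple F Z a b c ↔ IsPositiveTriple F Z a' b' c' :=
  ⟨hF.isPositiveTriple_of_share h4 h hd hsub, hF.isPositiveTriple_of_share h4 h' hd' hsub'⟩

/-- Under the condition on quadruples, all alternating triples have the same sign. -/
theorem IsABAFree.isPositiveTriple_iff (hF : IsABAFree F)
    (h4 : ∀ T : Finset S, T.card = 4 → (T : Set S) ⊆ D →
      ∃ A ∈ F, (∀ t ∈ T, (t ∈ A ↔ t ∈ Z)) ∨ ∀ t ∈ T, (t ∈ A ↔ t ∈ Zᶜ))
    {a b c a' b' c' : S} (h : IsAlternating D Z a b c) (h' : IsAlternating D Z a' b' c') :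
    IsPositiveTriple F Z a b c ↔ IsPositiveTriple F Z a' b' c' := by
  have same_first : ∀ {a b c b' c' : S}, IsAlternating D Z a b c → IsAlternating D Z a b' c' →
      (IsPositiveTriple F Z a b c ↔ IsPositiveTriple F Z a b' c') := by
    intro a b c b' c' h h'
    wlog hbb : b ≤ b' generalizing b c b' c'
    · exact (this h' h (le_of_not_ge hbb)).symm
    -- An intermediate triple sharing two vertices with each of the given ones; it is increasing
    -- because `b ≤ b' < c'`.
    have hm : IsAlternating D Z a b c' :=
      ⟨h.1, h.2.1, h'.2.2.1, h.2.2.2.1, hbb.trans_lt h'.2.2.2.2.1, h.2.2.2.2.2.1, by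
        have := h.2.2.2.2.2; have := h'.2.2.2.2.2; tauto⟩
    exact (hF.isPositiveTriple_iff_of_share h4 h hm hm.2.2.1 h.2.2.1 (by simp) (by simp)).trans
      (hF.isPositiveTriple_iff_of_share h4 hm h' h'.2.1 h.2.1 (by simp) (by simp))
  have same_type : ∀ {a b c a' b' c' : S}, IsAlternating D Z a b c → IsAlternating D Z a' b' c' →
      (a ∈ Z ↔ a' ∈ Z) → (IsPositiveTriple F Z a b c ↔ IsPositiveTriple F Z a' b' c') := by
    intro a b c a' b' c' h h' haZ
    wlog haa : a ≤ a' generalizing a b c a' b' c'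
    · exact (this h' h haZ.symm (le_of_not_ge haa)).symm
    have hm : IsAlternating D Z a b' c' :=
      ⟨h.1, h'.2.1, h'.2.2.1, haa.trans_lt h'.2.2.2.1, h'.2.2.2.2.1,
        haZ.trans h'.2.2.2.2.2.1, h'.2.2.2.2.2.2⟩
    exact (same_first h hm).trans
      (hF.isPositiveTriple_iff_of_share h4 hm h' h'.1 h.1 (by simp) (by simp))
  by_cases haZ : a ∈ Z ↔ a' ∈ Z
  · exact same_type h h' haZ
  wlog haa : a < a' generalizing a b c a' b' c'
  · refine (this h' h (fun e => haZ e.symm) (lt_of_le_of_ne (not_lt.1 haa) ?_)).symm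
    rintro rfl
    exact haZ Iff.rfl
  -- Since `a` and `a'` differ in `Z`, prepending `a` keeps the alternation and reduces to triples
  -- with the same first vertex.
  have hm : IsAlternating D Z a a' b' :=
    ⟨h.1, h'.1, h'.2.1, haa, h'.2.2.2.1, by tauto, h'.2.2.2.2.2.1⟩
  exact (same_type h hm Iff.rfl).trans
    (hF.isPositiveTriple_iff_of_share h4 hm h' h'.2.2.1 h.1 (by simp) (by simp))

/-- If some alternating triple obstructs `Z`, then it is positive for `Zᶜ`. -/
theorem exists_isPositiveTriple_compl_of_not_compatibleOn {A : Set S} (hA : A ∈ F)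
    (h : ¬ CompatibleOn (· < ·) D Z A) :
    ∃ a b c, IsAlternating D Z a b c ∧ IsPositiveTriple F Zᶜ a b c := by
  contrapose! h
  intro p hp q hq r hr hpq hqr
  constructor
  all_goals
    rintro ⟨h1, h2, h3⟩
    refine h p q r ⟨hp, hq, hr, hpq, hqr, ?_, ?_⟩ ⟨A, hA, ?_⟩
    · simp only [Set.mem_sdiff] at *
      tauto
    · simp only [Set.mem_sdiff] at *
      tauto
    · rintro t (rfl | rfl | rfl) <;> simp only [Set.mem_compl_iff, Set.mem_sdiff] at * <;> tauto

theorem IsABAFree.compatibleOn_or_compatibleOn_compl (hF : IsABAFree F)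
    (h4 : ∀ T : Finset S, T.card = 4 → (T : Set S) ⊆ D →
      ∃ A ∈ F, (∀ t ∈ T, (t ∈ A ↔ t ∈ Z)) ∨ ∀ t ∈ T, (t ∈ A ↔ t ∈ Zᶜ)) :
    (∀ A ∈ F, CompatibleOn (· < ·) D Z A) ∨ ∀ A ∈ F, CompatibleOn (· < ·) D Zᶜ A := by
  by_contra! hcon
  obtain ⟨⟨A, hA, hZA⟩, B, hB, hZB⟩ := hcon
  obtain ⟨a, b, c, h, hp⟩ := exists_isPositiveTriple_compl_of_not_compatibleOn hA hZA
  obtain ⟨a', b', c', h', hp'⟩ := exists_isPositiveTriple_compl_of_not_compatibleOn hB hZB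
  have h'' := h'.compl
  rw [compl_compl] at hp' h''
  exact hF.not_isPositiveTriple_compl h ((hF.isPositiveTriple_iff h4 h'' h).1 hp') hp

end
end

theorem theorem3p3 {S : Type*} [LinearOrder S] [Finite S] (H : Set (Set S))
    (hH : IsPseudohemisphereHypergraph H) (S' : Set S)
    (hS' : ∀ T : Finset S, T.card = 4 → (T : Set S) ⊆ S' → ∃ E ∈ H, (T : Set S) ⊆ E) :
    ∃ E : Set S, S' ⊆ E ∧ IsPseudohemisphereHypergraph (insert E H) := by
  obtain ⟨X, F, hF, hHF⟩ := hH
  have h4 : ∀ T : Finset S, T.card = 4 → (T : Set S) ⊆ S' →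
      ∃ A ∈ F, (∀ t ∈ T, (t ∈ A ↔ t ∈ X)) ∨ ∀ t ∈ T, (t ∈ A ↔ t ∈ Xᶜ) := by
    intro T hT hTS
    obtain ⟨E, hE, hTE⟩ := hS' T hT hTS
    obtain ⟨A, hA, rfl | rfl⟩ := hHF hE
    · refine ⟨A, hA, Or.inr fun t ht => ?_⟩
      have := hTE ht
      simp only [Set.mem_symmDiff, Set.mem_compl_iff] at *
      tauto
    · refine ⟨A, hA, Or.inl fun t ht => ?_⟩
      have := hTE ht
      simp only [Set.mem_symmDiff, Set.mem_compl_iff] at *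
      tauto
  have mem_of_insert : ∀ (Y E : Set S), IsABAFree (insert Y F) → (E = Y ∆ X ∨ E = Yᶜ ∆ X) →
      IsPseudohemisphereHypergraph (insert E H) := by
    refine fun Y E hY hE => ⟨X, insert Y F, hY, Set.insert_subset ⟨Y, Set.mem_insert _ _, hE⟩ ?_⟩
    intro E' hE'
    obtain ⟨A, hA, h⟩ := hHF hE'
    exact ⟨A, Set.mem_insert_of_mem _ hA, h⟩
  rcases hF.compatibleOn_or_compatibleOn_compl h4 with h | h
  · obtain ⟨Y, hY, hYF⟩ := hF.exists_insert h
    refine ⟨Yᶜ ∆ X, fun t ht => ?_, mem_of_insert Y _ hYF (Or.inr rfl)⟩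
    have := hY t ht
    simp only [Set.mem_symmDiff, Set.mem_compl_iff] at *
    tauto
  · obtain ⟨Y, hY, hYF⟩ := hF.exists_insert h
    refine ⟨Y ∆ X, fun t ht => ?_, mem_of_insert Y _ hYF (Or.inl rfl)⟩
    have := hY t ht
    simp only [Set.mem_symmDiff, Set.mem_compl_iff] at *
    tauto
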